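/- Let $p,q$ be real numbers with $1<q<p<\infty$, let $\ell_p,\ell_q$ be the real sequence spaces with their usual norms, and let $\mathbb X=\mathbb B(\ell_p,\ell_q)$ be the space of all bounded linear operators from $\ell_p$ to $\ell_q$ with the operator norm. Then for every $T\in\mathbb X$ the following are equivalent: (i) the norm of $\mathbb X$ is Gâteaux differentiable at $T$, i.e. the limit $\lim_{h\to 0}\frac{\|T+hA\|-\|T\|}{h}$ (with $h$ real, $h\neq 0$) exists for every $A\in\mathbb X$; (ii) the norm of $\mathbb X$ is Fréchet differentiable at $T$, i.e. the limit $\lim_{h\to 0}\frac{\|T+hA\|-\|T\|}{h}$ exists uniformly in $A\in\mathbb X$ with $\|A\|=1$. -/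

import Mathlib

open Filter Topology
open scoped ENNReal

/-- The norm of the real normed space `X` is Gâteaux differentiable at `x`:
the limit of `(‖x + h y‖ - ‖x‖) / h` as `h → 0` exists for every direction `y`. -/
def NormGateauxDifferentiableAt {X : Type*} [NormedAddCommGroup X] [NormedSpace ℝ X]
    (x : X) : Prop :=
  ∀ y : X, ∃ l : ℝ, Tendsto (fun h : ℝ => (‖x + h • y‖ - ‖x‖) / h) (𝓝[≠] 0) (𝓝 l)

/-- The norm of the real normed space `X` is Fréchet differentiable at `x`:
the limit of `(‖x + h y‖ - ‖x‖) / h` as `h → 0` exists uniformly in `y` on the unit sphere. -/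
def NormFrechetDifferentiableAt {X : Type*} [NormedAddCommGroup X] [NormedSpace ℝ X]
    (x : X) : Prop :=
  ∃ L : X → ℝ, TendstoUniformlyOn (fun (h : ℝ) (y : X) => (‖x + h • y‖ - ‖x‖) / h) L
    (𝓝[≠] 0) (Metric.sphere (0 : X) 1)

/-- The `ℓ_r`-norm of the pair `(a, b)` of nonnegative reals. -/
noncomputable def pairNorm (r a b : ℝ) : ℝ := (a ^ r + b ^ r) ^ (1 / r)

theorem pairNorm_rpow {r a b : ℝ} (hr : 0 < r) (ha : 0 ≤ a) (hb : 0 ≤ b) :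
    pairNorm r a b ^ r = a ^ r + b ^ r := by
  unfold pairNorm
  rw [← Real.rpow_mul (by positivity), one_div_mul_cancel hr.ne', Real.rpow_one]

theorem pairNorm_nonneg {r a b : ℝ} (ha : 0 ≤ a) (hb : 0 ≤ b) : 0 ≤ pairNorm r a b := by
  unfold pairNorm
  positivity

theorem pairNorm_one {a b : ℝ} : pairNorm 1 a b = a + b := by
  simp [pairNorm]

theorem pairNorm_mono {r a b a' b' : ℝ} (hr : 0 < r) (ha : 0 ≤ a) (hb : 0 ≤ b)
    (haa : a ≤ a') (hbb : b ≤ b') : pairNorm r a b ≤ pairNorm r a' b' := by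
  unfold pairNorm
  gcongr

theorem pairNorm_le_add {r a b : ℝ} (hr : 1 ≤ r) (ha : 0 ≤ a) (hb : 0 ≤ b) :
    pairNorm r a b ≤ a + b := by
  lift a to NNReal using ha
  lift b to NNReal using hb
  unfold pairNorm
  exact_mod_cast NNReal.rpow_add_rpow_le_add a b hr

theorem pairNorm_add_le {r a b c d : ℝ} (hr : 1 ≤ r) (ha : 0 ≤ a) (hb : 0 ≤ b) (hc : 0 ≤ c)
    (hd : 0 ≤ d) : pairNorm r (a + c) (b + d) ≤ pairNorm r a b + pairNorm r c d := by
  have h := Real.Lp_add_le_of_nonneg (s := (Finset.univ : Finset (Fin 2))) (f := ![a, b])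
    (g := ![c, d]) hr (by simp [Fin.forall_fin_two, ha, hb]) (by simp [Fin.forall_fin_two, hc, hd])
  simpa [pairNorm, Fin.sum_univ_two] using h

theorem pairNorm_le_pairNorm_add {r a b a' b' : ℝ} (hr : 1 ≤ r) (ha : 0 ≤ a) (hb : 0 ≤ b)
    (ha' : 0 ≤ a') (hb' : 0 ≤ b') :
    pairNorm r a b ≤ pairNorm r a' b' + (|a - a'| + |b - b'|) := by
  calc pairNorm r a b ≤ pairNorm r (a' + |a - a'|) (b' + |b - b'|) :=
        pairNorm_mono (by linarith) ha hb (by linarith [le_abs_self (a - a')])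
          (by linarith [le_abs_self (b - b')])
    _ ≤ pairNorm r a' b' + pairNorm r |a - a'| |b - b'| :=
        pairNorm_add_le hr ha' hb' (abs_nonneg _) (abs_nonneg _)
    _ ≤ _ := by
        gcongr
        exact pairNorm_le_add hr (abs_nonneg _) (abs_nonneg _)

theorem abs_pairNorm_sub_le {r a b a' b' : ℝ} (hr : 1 ≤ r) (ha : 0 ≤ a) (hb : 0 ≤ b)
    (ha' : 0 ≤ a') (hb' : 0 ≤ b') :
    |pairNorm r a b - pairNorm r a' b'| ≤ |a - a'| + |b - b'| := by
  have h₁ := pairNorm_le_pairNorm_add hr ha hb ha' hb'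
  have h₂ := pairNorm_le_pairNorm_add hr ha' hb' ha hb
  rw [abs_sub_comm a' a, abs_sub_comm b' b] at h₂
  rw [abs_le]
  constructor <;> linarith

/-- For exponents `r < s`, an `ℓ_r`-perturbation of a positive number of order `t` eventually beats
an `ℓ_s`-perturbation of order `t`. -/
theorem exists_mul_pairNorm_lt {r s M δ C : ℝ} (hr : 1 ≤ r) (hrs : r < s) (hM : 0 < M)
    (hδ : 0 < δ) (hC : 0 ≤ C) :
    ∃ t : ℝ, 0 < t ∧ M * pairNorm s 1 (t * C) < pairNorm r M (t * δ) := by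
  have hlim : Tendsto (fun t : ℝ => M ^ r * (C ^ s * t ^ (s - r))) (𝓝[>] 0) (𝓝 0) := by
    have h : ContinuousAt (fun t : ℝ => M ^ r * (C ^ s * t ^ (s - r))) 0 := by
      have : ContinuousAt (fun t : ℝ => t ^ (s - r)) 0 :=
        Real.continuousAt_rpow_const _ _ (Or.inr (by linarith))
      fun_prop
    have h' := h.tendsto
    simp only [Real.zero_rpow (sub_pos.2 hrs).ne', mul_zero] at h'
    exact h'.mono_left nhdsWithin_le_nhds
  obtain ⟨t, ht, ht0⟩ := ((hlim.eventually (gt_mem_nhds (Real.rpow_pos_of_pos hδ r))).and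
    self_mem_nhdsWithin).exists
  have ht0 : 0 < t := ht0
  refine ⟨t, ht0, ?_⟩
  have hr0 : 0 < r := by linarith
  have hs0 : 0 < s := by linarith
  rw [← Real.rpow_lt_rpow_iff (mul_nonneg hM.le (pairNorm_nonneg zero_le_one (by positivity)))
    (pairNorm_nonneg hM.le (by positivity)) hr0, pairNorm_rpow hr0 hM.le (by positivity),
    Real.mul_rpow hM.le (pairNorm_nonneg zero_le_one (by positivity))]
  have h1 : pairNorm s 1 (t * C) ^ r ≤ 1 + (t * C) ^ s := by
    unfold pairNorm
    rw [← Real.rpow_mul (by positivity), Real.one_rpow]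
    calc (1 + (t * C) ^ s) ^ (1 / s * r) ≤ (1 + (t * C) ^ s) ^ (1 : ℝ) := by
          apply Real.rpow_le_rpow_of_exponent_le
          · have : 0 ≤ (t * C) ^ s := by positivity
            linarith
          · rw [one_div_mul_eq_div, div_le_one hs0]
            exact hrs.le
      _ = _ := Real.rpow_one _
  have h2 : M ^ r * (t * C) ^ s < (t * δ) ^ r := by
    rw [Real.mul_rpow ht0.le hC, Real.mul_rpow ht0.le hδ.le]
    have : t ^ s = t ^ r * t ^ (s - r) := by rw [← Real.rpow_add ht0]; congr 1; ring
    rw [this]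
    have := mul_lt_mul_of_pos_left ht (Real.rpow_pos_of_pos ht0 r)
    calc _ = t ^ r * (M ^ r * (C ^ s * t ^ (s - r))) := by ring
      _ < _ := this
  calc M ^ r * pairNorm s 1 (t * C) ^ r ≤ M ^ r * (1 + (t * C) ^ s) := by gcongr
    _ < _ := by linarith

section lp

variable {p : ℝ≥0∞} [Fact (1 ≤ p)]

theorem one_le_toReal_of_fact (hp : p ≠ ∞) : 1 ≤ p.toReal := by
  have := ENNReal.toReal_mono hp (Fact.out : 1 ≤ p)
  simpa using this

theorem lp.norm_add_of_disjoint (hp : p ≠ ∞) (x y : lp (fun _ : ℕ => ℝ) p)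
    (h : ∀ i, x i = 0 ∨ y i = 0) : ‖x + y‖ = pairNorm p.toReal ‖x‖ ‖y‖ := by
  have hp0 : 0 < p.toReal := zero_lt_one.trans_le (one_le_toReal_of_fact hp)
  rw [← Real.rpow_left_inj (norm_nonneg _) (pairNorm_nonneg (norm_nonneg _) (norm_nonneg _))
    hp0.ne', pairNorm_rpow hp0 (norm_nonneg _) (norm_nonneg _)]
  refine (lp.hasSum_norm hp0 (x + y)).unique ?_
  convert (lp.hasSum_norm hp0 x).add (lp.hasSum_norm hp0 y) using 2 with i
  rcases h i with h | h <;> simp [h, Real.zero_rpow hp0.ne']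

theorem lp.abs_norm_add_sub_pairNorm_le (hp : p ≠ ∞) (x y : lp (fun _ : ℕ => ℝ) p)
    (s : Finset ℕ) :
    |‖x + y‖ - pairNorm p.toReal ‖x‖ ‖y‖| ≤
      2 * ‖x - ∑ i ∈ s, lp.single p i (x i)‖ + 2 * ‖∑ i ∈ s, lp.single p i (y i)‖ := by
  set a := ∑ i ∈ s, lp.single p i (x i) with ha
  set b := ∑ i ∈ s, lp.single p i (y i) with hb
  have happ : ∀ (z : lp (fun _ : ℕ => ℝ) p) (j : ℕ),
      (∑ i ∈ s, lp.single p i (z i) : lp (fun _ : ℕ => ℝ) p) j = if j ∈ s then z j else 0 := by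
    intro z j
    rw [lp.coeFn_sum, Finset.sum_apply]
    simp [Pi.single_apply]
  have h1 : ‖a + (y - b)‖ = pairNorm p.toReal ‖a‖ ‖y - b‖ := by
    apply lp.norm_add_of_disjoint hp
    intro i
    by_cases hi : i ∈ s
    · right
      rw [lp.coeFn_sub, Pi.sub_apply, hb, happ, if_pos hi, sub_self]
    · left
      rw [ha, happ, if_neg hi]
  have h2 : |‖x + y‖ - ‖a + (y - b)‖| ≤ ‖x - a‖ + ‖b‖ := by
    refine (abs_norm_sub_norm_le _ _).trans ?_
    rw [show x + y - (a + (y - b)) = (x - a) + b by abel]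
    exact norm_add_le _ _
  have h3 := abs_pairNorm_sub_le (one_le_toReal_of_fact hp) (norm_nonneg a) (norm_nonneg (y - b))
    (norm_nonneg x) (norm_nonneg y)
  have h4 : |‖a‖ - ‖x‖| ≤ ‖x - a‖ := by
    rw [abs_sub_comm]; exact abs_norm_sub_norm_le _ _
  have h5 : |‖y - b‖ - ‖y‖| ≤ ‖b‖ := by
    refine (abs_norm_sub_norm_le _ _).trans ?_
    simp
  rw [h1] at h2
  have := abs_sub_le ‖x + y‖ (pairNorm p.toReal ‖a‖ ‖y - b‖) (pairNorm p.toReal ‖x‖ ‖y‖)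
  linarith

/-- A form of the Brezis–Lieb lemma in `ℓ_p`: perturbing `x` by coordinatewise null `y` acts on
norms like an `ℓ_p`-sum. -/
theorem lp.tendsto_norm_add_sub_pairNorm (hp : p ≠ ∞) {ι : Type*} {l : Filter ι}
    (x : lp (fun _ : ℕ => ℝ) p) {y : ι → lp (fun _ : ℕ => ℝ) p}
    (hy : ∀ i, Tendsto (fun n => y n i) l (𝓝 0)) :
    Tendsto (fun n => ‖x + y n‖ - pairNorm p.toReal ‖x‖ ‖y n‖) l (𝓝 0) := by
  rw [Metric.tendsto_nhds]
  intro ε hε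
  have hx := lp.hasSum_single hp x
  rw [HasSum, Metric.tendsto_nhds] at hx
  obtain ⟨s, hs⟩ := (hx (ε / 4) (by positivity)).exists
  rw [dist_comm, dist_eq_norm] at hs
  have hlim : Tendsto (fun n => ‖∑ i ∈ s, lp.single (E := fun _ : ℕ => ℝ) p i (y n i)‖) l
      (𝓝 0) := by
    have : Tendsto (fun n => ∑ i ∈ s, lp.single (E := fun _ : ℕ => ℝ) p i (y n i)) l
        (𝓝 (∑ i ∈ s, lp.single (E := fun _ : ℕ => ℝ) p i 0)) :=
      tendsto_finsetSum _ fun i _ =>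
        ((lp.isometry_single (E := fun _ : ℕ => ℝ) i).continuous.tendsto 0).comp (hy i)
    simpa using this.norm
  filter_upwards [hlim.eventually (gt_mem_nhds (show 0 < ε / 4 by positivity))] with n hn
  rw [dist_zero_right, Real.norm_eq_abs]
  have := lp.abs_norm_add_sub_pairNorm_le hp x (y n) s
  linarith

/-- Along an ultrafilter, a bounded family in `ℓ_p` converges coordinatewise. -/
theorem lp.exists_coordinatewise_limit {ι : Type*} (l : Ultrafilter ι)
    {x : ι → lp (fun _ : ℕ => ℝ) p} {C : ℝ} (hx : ∀ n, ‖x n‖ ≤ C) :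
    ∃ a : lp (fun _ : ℕ => ℝ) p, ‖a‖ ≤ C ∧ ∀ i, Tendsto (fun n => (x n - a) i) l (𝓝 0) := by
  have hp0 : p ≠ 0 := (zero_lt_one.trans_le Fact.out).ne'
  have : ∀ i, ∃ c : ℝ, Tendsto (fun n => x n i) l (𝓝 c) := by
    intro i
    obtain ⟨c, -, hc⟩ := (isCompact_closedBall (0 : ℝ) C).ultrafilter_le_nhds
      (l.map fun n => x n i) (by
        rw [Filter.le_principal_iff, Ultrafilter.mem_coe, Ultrafilter.mem_map]
        refine Filter.univ_mem' (f := (l : Filter ι)) fun n => ?_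
        rw [Set.mem_preimage, mem_closedBall_zero_iff]
        exact (lp.norm_apply_le_norm hp0 (x n) i).trans (hx n))
    exact ⟨c, hc⟩
  choose c hc using this
  have hc' : Tendsto (id fun n => x n : ι → ℕ → ℝ) l (𝓝 c) := tendsto_pi_nhds.2 hc
  have hbdd : Bornology.IsBounded (Set.range x) :=
    isBounded_iff_forall_norm_le.2 ⟨C, Set.forall_mem_range.2 hx⟩
  refine ⟨⟨c, lp.memℓp_of_tendsto hbdd hc'⟩,
    lp.norm_le_of_tendsto (Eventually.of_forall hx) hc', fun i => ?_⟩
  exact tendsto_sub_nhds_zero_iff.2 (hc i)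

end lp

section lp

variable {p : ℝ≥0∞} [Fact (1 ≤ p)]

/-- The Delpech argument for the Pitt theorem. Let `T n` be operators on `ℓ_p` of norm at most `M`,
asymptotically almost normed by a fixed vector, and `y n` a bounded coordinatewise null family.
If on the range side perturbations by `T n (y n)` act at least like an `ℓ_r`-sum with `r < p`, then
`T n (y n)` tends to zero. -/
theorem lp.tendsto_apply_zero_of_pairNorm_le_max (hp : p ≠ ∞) {r : ℝ} (hr : 1 ≤ r)
    (hrp : r < p.toReal) {F : Type*} [NormedAddCommGroup F] [NormedSpace ℝ F] {ι : Type*}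
    {l : Filter ι} {T : ι → lp (fun _ : ℕ => ℝ) p →L[ℝ] F} {M : ℝ} (hM : 0 < M)
    (hT : ∀ n, ‖T n‖ ≤ M)
    (hnorm : ∀ ε > 0, ∃ z, ‖z‖ ≤ 1 ∧ ∀ᶠ n in l, M - ε ≤ ‖T n z‖)
    {y : ι → lp (fun _ : ℕ => ℝ) p} {C : ℝ} (hC : 0 ≤ C) (hyC : ∀ n, ‖y n‖ ≤ C)
    (hy : ∀ i, Tendsto (fun n => y n i) l (𝓝 0))
    (hmax : ∀ z, ∀ t > 0, ∀ ε > 0, ∀ᶠ n in l, pairNorm r ‖T n z‖ (t * ‖T n (y n)‖) - ε ≤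
      max ‖T n (z + t • y n)‖ ‖T n (z - t • y n)‖) :
    Tendsto (fun n => T n (y n)) l (𝓝 0) := by
  rw [Metric.tendsto_nhds]
  intro δ hδ
  by_contra hfreq
  have hfreq : ∃ᶠ n in l, δ ≤ ‖T n (y n)‖ := by
    rw [Filter.Frequently]
    simpa only [not_le, dist_zero_right] using hfreq
  obtain ⟨t, ht, hlt⟩ := exists_mul_pairNorm_lt (s := p.toReal) hr hrp hM hδ hC
  obtain ⟨ε, hε, hεM, hεlt⟩ : ∃ ε > 0, ε < M ∧
      ε * (M + 2) < pairNorm r M (t * δ) - M * pairNorm p.toReal 1 (t * C) := by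
    set D := pairNorm r M (t * δ) - M * pairNorm p.toReal 1 (t * C) with hD
    have hD0 : 0 < D := by linarith
    refine ⟨min (M / 2) (D / (2 * (M + 2))), by positivity,
      (min_le_left _ _).trans_lt (by linarith), ?_⟩
    calc _ ≤ D / (2 * (M + 2)) * (M + 2) := by gcongr; exact min_le_right _ _
      _ = D / 2 := by field_simp
      _ < D := by linarith
  obtain ⟨z, hz, hTz⟩ := hnorm ε hε
  have hp1 := one_le_toReal_of_fact hp
  have hupper : ∀ c : ℝ, |c| = t → ∀ᶠ n in l, ‖T n (z + c • y n)‖ ≤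
      M * (pairNorm p.toReal 1 (t * C) + ε) := by
    intro c hc
    have hy' : ∀ i, Tendsto (fun n => (c • y n) i) l (𝓝 0) := fun i => by
      simpa using (hy i).const_mul c
    filter_upwards [(lp.tendsto_norm_add_sub_pairNorm hp z hy').eventually (gt_mem_nhds hε)]
      with n hn
    have h1 : pairNorm p.toReal ‖z‖ ‖c • y n‖ ≤ pairNorm p.toReal 1 (t * C) := by
      apply pairNorm_mono (by linarith) (norm_nonneg _) (norm_nonneg _) hz
      rw [norm_smul, Real.norm_eq_abs, hc]
      gcongr
      exact hyC n
    calc ‖T n (z + c • y n)‖ ≤ ‖T n‖ * ‖z + c • y n‖ := (T n).le_opNorm _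
      _ ≤ M * (pairNorm p.toReal 1 (t * C) + ε) := by
        gcongr
        · exact hT n
        · linarith
  obtain ⟨n, hn, hn1, hn2, hn3, hn4⟩ := (hfreq.and_eventually (hTz.and
    ((hmax z t ht ε hε).and ((hupper t (abs_of_pos ht)).and
      (hupper (-t) (by rw [abs_neg, abs_of_pos ht])))))).exists
  rw [neg_smul, ← sub_eq_add_neg] at hn4
  have h1 : pairNorm r (M - ε) (t * δ) ≤ pairNorm r ‖T n z‖ (t * ‖T n (y n)‖) :=
    pairNorm_mono (by linarith) (by linarith) (by positivity) hn1 (by gcongr)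
  have h2 : pairNorm r M (t * δ) ≤ pairNorm r (M - ε) (t * δ) + ε := by
    have := pairNorm_le_pairNorm_add hr hM.le (show 0 ≤ t * δ by positivity)
      (show 0 ≤ M - ε by linarith) (show 0 ≤ t * δ by positivity)
    simpa [abs_of_pos hε] using this
  have h3 := hn2.trans (max_le hn3 hn4)
  linarith

theorem ContinuousLinearMap.exists_norm_le_one_sub_le {E F : Type*} [NormedAddCommGroup E]
    [NormedSpace ℝ E] [NormedAddCommGroup F] [NormedSpace ℝ F] (T : E →L[ℝ] F) {ε : ℝ}
    (hε : 0 < ε) : ∃ z, ‖z‖ ≤ 1 ∧ ‖T‖ - ε ≤ ‖T z‖ := by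
  by_contra! h
  have h0 : 0 ≤ ‖T‖ - ε := by
    have := h 0 (by simp)
    simp only [map_zero, norm_zero] at this
    exact this.le
  have := T.opNorm_le_of_unit_norm h0 fun x hx => (h x hx.le).le
  linarith

theorem add_abs_le_max_abs (a b : ℝ) : |a| + |b| ≤ max |a + b| |a - b| := by
  rcases abs_cases a with ⟨ha, _⟩ | ⟨ha, _⟩ <;> rcases abs_cases b with ⟨hb, _⟩ | ⟨hb, _⟩ <;>
    rw [ha, hb, le_max_iff]
  · left; exact le_abs_self _
  · right; linarith [le_abs_self (a - b)]
  · right; linarith [neg_abs_le (a - b)]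
  · left; linarith [neg_abs_le (a + b)]

/-- The scalar-valued case of `lp.tendsto_apply_zero_of_pairNorm_le_max`. -/
theorem lp.tendsto_functional_apply_zero (hp1 : 1 < p) (hp : p ≠ ∞) {ι : Type*} {l : Filter ι}
    {g : ι → lp (fun _ : ℕ => ℝ) p →L[ℝ] ℝ} {M : ℝ} (hM : 0 < M) (hg : ∀ n, ‖g n‖ ≤ M)
    (hnorm : ∀ ε > 0, ∃ z, ‖z‖ ≤ 1 ∧ ∀ᶠ n in l, M - ε ≤ ‖g n z‖)
    {y : ι → lp (fun _ : ℕ => ℝ) p} {C : ℝ} (hC : 0 ≤ C) (hyC : ∀ n, ‖y n‖ ≤ C)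
    (hy : ∀ i, Tendsto (fun n => y n i) l (𝓝 0)) :
    Tendsto (fun n => g n (y n)) l (𝓝 0) := by
  have hp1' : 1 < p.toReal := by
    have := (ENNReal.toReal_lt_toReal ENNReal.one_ne_top hp).2 hp1
    simpa using this
  refine lp.tendsto_apply_zero_of_pairNorm_le_max hp le_rfl hp1' hM hg hnorm hC hyC hy ?_
  refine fun z t ht ε hε => Eventually.of_forall fun n => ?_
  rw [pairNorm_one]
  have := add_abs_le_max_abs (g n z) (t * g n (y n))
  rw [abs_mul, abs_of_pos ht] at this
  simp only [map_add, map_sub, map_smul, smul_eq_mul, Real.norm_eq_abs]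
  linarith

/-- Bounded coordinatewise null families in `ℓ_p`, `1 < p < ∞`, are weakly null. -/
theorem lp.tendsto_dual_apply_zero (hp1 : 1 < p) (hp : p ≠ ∞) {ι : Type*} {l : Filter ι}
    (g : lp (fun _ : ℕ => ℝ) p →L[ℝ] ℝ)
    {y : ι → lp (fun _ : ℕ => ℝ) p} {C : ℝ} (hC : 0 ≤ C) (hyC : ∀ n, ‖y n‖ ≤ C)
    (hy : ∀ i, Tendsto (fun n => y n i) l (𝓝 0)) :
    Tendsto (fun n => g (y n)) l (𝓝 0) := by
  rcases eq_or_ne g 0 with rfl | hg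
  · simpa using tendsto_const_nhds
  refine lp.tendsto_functional_apply_zero (g := fun _ => g) hp1 hp (norm_pos_iff.2 hg)
    (fun _ => le_rfl) (fun ε hε => ?_) hC hyC hy
  obtain ⟨z, hz, h⟩ := g.exists_norm_le_one_sub_le hε
  exact ⟨z, hz, Eventually.of_forall fun _ => h⟩

/-- The **Pitt theorem**: for `1 < q < p < ∞`, operators `ℓ_p → ℓ_q` map bounded coordinatewise null
families to norm null families. -/
theorem lp.tendsto_apply_zero_of_lt {q : ℝ≥0∞} [Fact (1 ≤ q)] (hq : 1 < q) (hqp : q < p)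
    (hp : p ≠ ∞) {ι : Type*} {l : Filter ι}
    (T : lp (fun _ : ℕ => ℝ) p →L[ℝ] lp (fun _ : ℕ => ℝ) q)
    {y : ι → lp (fun _ : ℕ => ℝ) p} {C : ℝ} (hC : 0 ≤ C) (hyC : ∀ n, ‖y n‖ ≤ C)
    (hy : ∀ i, Tendsto (fun n => y n i) l (𝓝 0)) :
    Tendsto (fun n => T (y n)) l (𝓝 0) := by
  rcases eq_or_ne T 0 with rfl | hT
  · simpa using tendsto_const_nhds
  have hq' : q ≠ ∞ := (hqp.trans_le le_top).ne
  refine lp.tendsto_apply_zero_of_pairNorm_le_max (T := fun _ => T) hp (one_le_toReal_of_fact hq')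
    ((ENNReal.toReal_lt_toReal hq' hp).2 hqp) (norm_pos_iff.2 hT)
    (fun _ => le_rfl) (fun ε hε => ?_) hC hyC hy (fun z t ht ε hε => ?_)
  · obtain ⟨z, hz, h⟩ := T.exists_norm_le_one_sub_le hε
    exact ⟨z, hz, Eventually.of_forall fun _ => h⟩
  · have hTy : ∀ i, Tendsto (fun n => (t • T (y n)) i) l (𝓝 0) := by
      intro i
      have := (lp.tendsto_dual_apply_zero (hq.trans hqp) hp
        ((lp.evalCLM ℝ (fun _ : ℕ => ℝ) q i).comp T) hC hyC hy).const_mul t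
      rw [mul_zero] at this
      exact this
    filter_upwards [(lp.tendsto_norm_add_sub_pairNorm hq' (T z) hTy).eventually
      (lt_mem_nhds (neg_lt_zero.2 hε))] with n hn
    rw [norm_smul, Real.norm_eq_abs, abs_of_pos ht] at hn
    refine le_trans ?_ (le_max_left _ _)
    rw [map_add, map_smul]
    linarith

/-- The Radon–Riesz property of `ℓ_p` for coordinatewise convergence to a unit vector. -/
theorem lp.tendsto_zero_of_norm_add_le_one (hp : p ≠ ∞) {ι : Type*} {l : Filter ι}
    {x : lp (fun _ : ℕ => ℝ) p} (hx : ‖x‖ = 1) {y : ι → lp (fun _ : ℕ => ℝ) p}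
    (hy : ∀ i, Tendsto (fun n => y n i) l (𝓝 0)) (hxy : ∀ n, ‖x + y n‖ ≤ 1) :
    Tendsto y l (𝓝 0) := by
  have hp1 := one_le_toReal_of_fact hp
  have hp0 : 0 < p.toReal := by linarith
  rw [Metric.tendsto_nhds]
  intro δ hδ
  obtain ⟨c, hc1, hc⟩ : ∃ c, 1 < c ∧ c < pairNorm p.toReal 1 δ := by
    apply exists_between
    rw [← Real.rpow_lt_rpow_iff zero_le_one (pairNorm_nonneg zero_le_one hδ.le) hp0,
      pairNorm_rpow hp0 zero_le_one hδ.le, Real.one_rpow]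
    linarith [Real.rpow_pos_of_pos hδ p.toReal]
  filter_upwards [(lp.tendsto_norm_add_sub_pairNorm hp x hy).eventually
    (lt_mem_nhds (show 1 - c < 0 by linarith))] with n hn
  rw [dist_zero_right]
  by_contra! h
  have := pairNorm_mono hp0 zero_le_one hδ.le le_rfl h
  rw [hx] at hn
  linarith [hxy n]

/-- In the dual of `ℓ_q`, `1 < q < ∞`, weak-star convergence of functionals of norm at most one to
a functional attaining its norm one is norm convergence. -/
theorem lp.tendsto_dual_of_tendsto_apply (hp1 : 1 < p) (hp : p ≠ ∞) {ι : Type*}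
    (l : Ultrafilter ι) {g : ι → lp (fun _ : ℕ => ℝ) p →L[ℝ] ℝ}
    {g₀ : lp (fun _ : ℕ => ℝ) p →L[ℝ] ℝ} (hg : ∀ n, ‖g n‖ ≤ 1)
    (hlim : ∀ z, Tendsto (fun n => g n z) l (𝓝 (g₀ z)))
    {z : lp (fun _ : ℕ => ℝ) p} (hz : ‖z‖ ≤ 1) (hgz : g₀ z = 1) :
    Tendsto (fun n => ‖g n - g₀‖) l (𝓝 0) := by
  have hex : ∀ n, ∃ w : lp (fun _ : ℕ => ℝ) p, ‖w‖ ≤ 1 ∧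
      ‖g n - g₀‖ ≤ 2 * ‖(g n - g₀) w‖ := by
    intro n
    rcases eq_or_ne (g n - g₀) 0 with h | h
    · exact ⟨0, by simp [h]⟩
    · obtain ⟨w, hw, h'⟩ := (g n - g₀).exists_norm_le_one_sub_le
        (half_pos (norm_pos_iff.2 h))
      exact ⟨w, hw, by linarith⟩
  choose w hw hgw using hex
  obtain ⟨a, ha, hwa⟩ := lp.exists_coordinatewise_limit l hw
  have hbd : ∀ n, ‖w n - a‖ ≤ 2 := fun n =>
    (norm_sub_le _ _).trans (by linarith [hw n])
  have h1 : Tendsto (fun n => g n (w n - a)) l (𝓝 0) := by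
    refine lp.tendsto_functional_apply_zero hp1 hp one_pos hg (fun ε hε => ⟨z, hz, ?_⟩)
      zero_le_two hbd hwa
    have := hlim z
    rw [hgz] at this
    filter_upwards [this.eventually (lt_mem_nhds (show 1 - ε < 1 by linarith))] with n hn
    exact hn.le.trans (le_abs_self _)
  have h2 := lp.tendsto_dual_apply_zero hp1 hp g₀ zero_le_two hbd hwa
  have h3 : Tendsto (fun n => g n a - g₀ a) l (𝓝 0) := tendsto_sub_nhds_zero_iff.2 (hlim a)
  have h4 : Tendsto (fun n => 2 * ‖(g n - g₀) (w n)‖) l (𝓝 0) := by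
    have := (((h1.sub h2).add h3).norm).const_mul 2
    simp only [sub_zero, add_zero, _root_.norm_zero, mul_zero] at this
    refine this.congr fun n => ?_
    rw [_root_.sub_apply, map_sub, map_sub]
    congr 2
    ring
  exact squeeze_zero (fun _ => norm_nonneg _) hgw h4

end lp

theorem NormFrechetDifferentiableAt.normGateauxDifferentiableAt {X : Type*}
    [NormedAddCommGroup X] [NormedSpace ℝ X] {x : X} (hx : NormFrechetDifferentiableAt x) :
    NormGateauxDifferentiableAt x := by
  obtain ⟨L, hL⟩ := hx
  intro y
  rcases eq_or_ne y 0 with rfl | hy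
  · exact ⟨0, by simp⟩
  have hy0 : 0 < ‖y‖ := norm_pos_iff.2 hy
  have hu : ‖y‖⁻¹ • y ∈ Metric.sphere (0 : X) 1 := by
    rw [mem_sphere_zero_iff_norm, norm_smul, norm_inv, norm_norm, inv_mul_cancel₀ hy0.ne']
  have hscale : Tendsto (fun h : ℝ => h * ‖y‖) (𝓝[≠] 0) (𝓝[≠] 0) := by
    refine tendsto_nhdsWithin_iff.2 ⟨?_, ?_⟩
    · have : Tendsto (fun h : ℝ => h * ‖y‖) (𝓝 0) (𝓝 (0 * ‖y‖)) := by
        exact (continuous_mul_const ‖y‖).tendsto 0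
      rw [zero_mul] at this
      exact this.mono_left nhdsWithin_le_nhds
    · filter_upwards [self_mem_nhdsWithin] with h hh
      exact mul_ne_zero hh hy0.ne'
  refine ⟨‖y‖ * L (‖y‖⁻¹ • y), (((hL.tendsto_at hu).comp hscale).const_mul ‖y‖).congr ?_⟩
  intro h
  simp only [Function.comp_apply, smul_smul, mul_assoc, mul_inv_cancel₀ hy0.ne', mul_one]
  rw [mul_comm h, mul_div_assoc', mul_div_mul_left _ _ hy0.ne']

theorem NormGateauxDifferentiableAt.eq_zero_of_zero {X : Type*} [NormedAddCommGroup X]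
    [NormedSpace ℝ X] (h : NormGateauxDifferentiableAt (0 : X)) (y : X) : y = 0 := by
  obtain ⟨c, hc⟩ := h y
  simp only [zero_add, norm_zero, sub_zero, norm_smul, Real.norm_eq_abs] at hc
  have h1 : c = ‖y‖ := by
    refine tendsto_nhds_unique
      ((hc.mono_left (nhdsGT_le_nhdsNE 0)).congr' ?_)
      tendsto_const_nhds
    filter_upwards [self_mem_nhdsWithin] with a ha
    rw [abs_of_pos ha, mul_div_cancel_left₀ _ (ne_of_gt ha)]
  have h2 : c = -‖y‖ := by
    refine tendsto_nhds_unique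
      ((hc.mono_left (nhdsLT_le_nhdsNE 0)).congr' ?_)
      tendsto_const_nhds
    filter_upwards [self_mem_nhdsWithin] with a ha
    rw [abs_of_neg ha, neg_mul, neg_div, mul_div_cancel_left₀ _ (ne_of_lt ha)]
  rw [← norm_eq_zero]
  linarith

/-- If the norm has a two-sided directional derivative, then it is the value of any subgradient in
that direction. -/
theorem eq_of_tendsto_of_mul_le {X : Type*} [NormedAddCommGroup X] [NormedSpace ℝ X] {x y : X}
    {c d : ℝ} (hc : Tendsto (fun h : ℝ => (‖x + h • y‖ - ‖x‖) / h) (𝓝[≠] 0) (𝓝 c))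
    (hd : ∀ h : ℝ, h * d ≤ ‖x + h • y‖ - ‖x‖) : c = d := by
  apply le_antisymm
  · refine le_of_tendsto (hc.mono_left (nhdsLT_le_nhdsNE 0)) ?_
    filter_upwards [self_mem_nhdsWithin] with a ha
    rw [div_le_iff_of_neg ha]
    linarith [hd a]
  · refine ge_of_tendsto (hc.mono_left (nhdsGT_le_nhdsNE 0)) ?_
    filter_upwards [self_mem_nhdsWithin] with a ha
    rw [le_div_iff₀ ha]
    linarith [hd a]

/-- Along an ultrafilter, a family of functionals of norm at most one converges pointwise. -/
theorem exists_tendsto_apply_of_norm_le_one {E : Type*} [NormedAddCommGroup E] [NormedSpace ℝ E]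
    {ι : Type*} (l : Ultrafilter ι) {g : ι → E →L[ℝ] ℝ} (hg : ∀ n, ‖g n‖ ≤ 1) :
    ∃ g₀ : E →L[ℝ] ℝ, ‖g₀‖ ≤ 1 ∧ ∀ z, Tendsto (fun n => g n z) l (𝓝 (g₀ z)) := by
  obtain ⟨g₀, hg₀, hlim⟩ :=
    (WeakDual.isCompact_closedBall (𝕜 := ℝ) (E := E) 0 1).ultrafilter_le_nhds
    (l.map fun n => StrongDual.toWeakDual (g n)) (by
      rw [Filter.le_principal_iff, Ultrafilter.mem_coe, Ultrafilter.mem_map]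
      refine Filter.univ_mem' (f := (l : Filter ι)) fun n => ?_
      rw [Set.mem_preimage, Set.mem_preimage, mem_closedBall_zero_iff]
      exact hg n)
  refine ⟨WeakDual.toStrongDual g₀, mem_closedBall_zero_iff.1 hg₀, fun z => ?_⟩
  exact (WeakDual.eval_continuous z).continuousAt.tendsto.comp hlim

theorem ContinuousLinearMap.abs_apply_apply_le {E F : Type*} [NormedAddCommGroup E]
    [NormedSpace ℝ E] [NormedAddCommGroup F] [NormedSpace ℝ F] {S : E →L[ℝ] F} {f : F →L[ℝ] ℝ}
    {w : E} (hf : ‖f‖ ≤ 1) (hw : ‖w‖ ≤ 1) : |f (S w)| ≤ ‖S‖ :=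
  (f.le_of_opNorm_le_of_le hf (S.le_of_opNorm_le_of_le le_rfl hw)).trans (by simp)

theorem ContinuousLinearMap.abs_apply_apply_sub_le {E F : Type*} [NormedAddCommGroup E]
    [NormedSpace ℝ E] [NormedAddCommGroup F] [NormedSpace ℝ F] {A : E →L[ℝ] F} {g g₀ : F →L[ℝ] ℝ}
    {x x₀ : E} (hA : ‖A‖ ≤ 1) (hg₀ : ‖g₀‖ ≤ 1) (hx : ‖x‖ ≤ 1) :
    |g (A x) - g₀ (A x₀)| ≤ ‖g - g₀‖ + ‖x - x₀‖ := by
  have h : g (A x) - g₀ (A x₀) = (g - g₀) (A x) + g₀ (A (x - x₀)) := by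
    simp
  have h1 : ‖A x‖ ≤ 1 := (A.le_of_opNorm_le_of_le hA hx).trans (by simp)
  have h2 : ‖A (x - x₀)‖ ≤ ‖x - x₀‖ := (A.le_of_opNorm_le hA _).trans (by simp)
  rw [h]
  refine (abs_add_le _ _).trans (add_le_add ?_ ?_)
  · exact ((g - g₀).le_of_opNorm_le_of_le le_rfl h1).trans (by simp)
  · exact (g₀.le_of_opNorm_le_of_le hg₀ h2).trans (by simp)

section lp

variable {p q : ℝ≥0∞} [Fact (1 ≤ p)] [Fact (1 ≤ q)]

/-- Almost norming pairs for small perturbations of an operator `ℓ_p → ℓ_q` converge in norm, along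
an ultrafilter, to a norming pair of the operator. -/
theorem lp.exists_tendsto_norming_pair (hq : 1 < q) (hqp : q < p) (hp : p ≠ ∞)
    {T : lp (fun _ : ℕ => ℝ) p →L[ℝ] lp (fun _ : ℕ => ℝ) q} (hT : T ≠ 0) {ι : Type*}
    (l : Ultrafilter ι) {x : ι → lp (fun _ : ℕ => ℝ) p}
    {g : ι → lp (fun _ : ℕ => ℝ) q →L[ℝ] ℝ} (hx : ∀ n, ‖x n‖ ≤ 1) (hg : ∀ n, ‖g n‖ ≤ 1)
    (hlim : Tendsto (fun n => g n (T (x n))) l (𝓝 ‖T‖)) :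
    ∃ (x₀ : lp (fun _ : ℕ => ℝ) p) (g₀ : lp (fun _ : ℕ => ℝ) q →L[ℝ] ℝ), ‖x₀‖ ≤ 1 ∧ ‖g₀‖ ≤ 1 ∧
      g₀ (T x₀) = ‖T‖ ∧ Tendsto (fun n => ‖x n - x₀‖) l (𝓝 0) ∧
      Tendsto (fun n => ‖g n - g₀‖) l (𝓝 0) := by
  have hT0 : 0 < ‖T‖ := norm_pos_iff.2 hT
  obtain ⟨x₀, hx₀, hxlim⟩ := lp.exists_coordinatewise_limit l hx
  obtain ⟨g₀, hg₀, hglim⟩ := exists_tendsto_apply_of_norm_le_one l hg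
  have hpitt := lp.tendsto_apply_zero_of_lt hq hqp hp T zero_le_two
    (fun n => (norm_sub_le (x n) x₀).trans (by linarith [hx n])) hxlim
  have hsmall : Tendsto (fun n => g n (T (x n - x₀))) l (𝓝 0) := by
    refine squeeze_zero_norm (fun n => ?_) (by simpa using hpitt.norm)
    exact ((g n).le_of_opNorm_le (hg n) _).trans (by simp)
  have hgT : g₀ (T x₀) = ‖T‖ := by
    refine tendsto_nhds_unique (hglim (T x₀)) ?_
    have := hlim.sub hsmall
    rw [sub_zero] at this
    exact this.congr fun n => by simp
  have hx₀1 : ‖x₀‖ = 1 := by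
    refine le_antisymm hx₀ ?_
    have h1 : g₀ (T x₀) ≤ ‖T x₀‖ :=
      (le_abs_self _).trans ((g₀.le_of_opNorm_le hg₀ _).trans (by simp))
    have h2 := T.le_opNorm x₀
    rw [hgT] at h1
    exact le_of_mul_le_mul_left (by linarith) hT0
  refine ⟨x₀, g₀, hx₀, hg₀, hgT, ?_, ?_⟩
  · have := lp.tendsto_zero_of_norm_add_le_one hp hx₀1 hxlim (by simpa using hx)
    simpa using this.norm
  · refine lp.tendsto_dual_of_tendsto_apply hq (hqp.trans_le le_top).ne l hg hglim
      (z := ‖T‖⁻¹ • T x₀) ?_ ?_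
    · rw [norm_smul, norm_inv, _root_.norm_norm, inv_mul_le_one₀ hT0]
      exact (T.le_opNorm x₀).trans (by rw [hx₀1, mul_one])
    · rw [map_smul, hgT, smul_eq_mul, inv_mul_cancel₀ (ne_of_gt hT0)]

/-- At a Gâteaux differentiability point of the operator norm, difference quotients in varying
directions of norm at most one approach the directional derivatives along ultrafilters. -/
theorem lp.tendsto_quotient_sub_of_tendsto (hq : 1 < q) (hqp : q < p) (hp : p ≠ ∞)
    {T : lp (fun _ : ℕ => ℝ) p →L[ℝ] lp (fun _ : ℕ => ℝ) q} (hT : T ≠ 0)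
    {L : (lp (fun _ : ℕ => ℝ) p →L[ℝ] lp (fun _ : ℕ => ℝ) q) → ℝ}
    (hL : ∀ A, Tendsto (fun h : ℝ => (‖T + h • A‖ - ‖T‖) / h) (𝓝[≠] 0) (𝓝 (L A)))
    {l : Ultrafilter ℝ} (hl : (l : Filter ℝ) ≤ 𝓝[≠] 0)
    {A : ℝ → lp (fun _ : ℕ => ℝ) p →L[ℝ] lp (fun _ : ℕ => ℝ) q} (hA : ∀ h, ‖A h‖ ≤ 1) :
    Tendsto (fun h => (‖T + h • A h‖ - ‖T‖) / h - L (A h)) l (𝓝 0) := by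
  have hex : ∀ h : ℝ, ∃ (x : lp (fun _ : ℕ => ℝ) p) (g : lp (fun _ : ℕ => ℝ) q →L[ℝ] ℝ),
      ‖x‖ ≤ 1 ∧ ‖g‖ ≤ 1 ∧ (h ≠ 0 → ‖T + h • A h‖ - h ^ 2 ≤ g ((T + h • A h) x)) := by
    intro h
    rcases eq_or_ne h 0 with rfl | hh
    · exact ⟨0, 0, by simp⟩
    · obtain ⟨x, hx, hx'⟩ := (T + h • A h).exists_norm_le_one_sub_le (ε := h ^ 2) (by positivity)
      obtain ⟨g, hg, hg'⟩ := exists_dual_vector'' ℝ ((T + h • A h) x)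
      exact ⟨x, g, hx, hg, fun _ => hx'.trans_eq hg'.symm⟩
  choose x g hx hg hxg using hex
  have hne : ∀ᶠ h in (l : Filter ℝ), h ≠ 0 := hl self_mem_nhdsWithin
  have hid : Tendsto (fun h : ℝ => h) l (𝓝 0) := hl.trans nhdsWithin_le_nhds
  have habs : Tendsto (fun h : ℝ => |h|) l (𝓝 0) := by simpa using hid.abs
  have hgT : ∀ h, g h (T (x h)) ≤ ‖T‖ := fun h =>
    (le_abs_self _).trans (ContinuousLinearMap.abs_apply_apply_le (hg h) (hx h))
  have hgA : ∀ h, |h * g h (A h (x h))| ≤ |h| := fun h => by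
    rw [abs_mul]
    exact mul_le_of_le_one_right (abs_nonneg _)
      ((ContinuousLinearMap.abs_apply_apply_le (hg h) (hx h)).trans (hA h))
  have hexp : ∀ h, g h ((T + h • A h) (x h)) = g h (T (x h)) + h * g h (A h (x h)) := fun h => by
    simp
  have hlim : Tendsto (fun h => g h (T (x h))) l (𝓝 ‖T‖) := by
    have hlow : Tendsto (fun h : ℝ => ‖T‖ - (2 * |h| + h ^ 2)) l (𝓝 ‖T‖) := by
      simpa using ((habs.const_mul 2).add (hid.pow 2)).const_sub ‖T‖
    refine tendsto_of_tendsto_of_tendsto_of_le_of_le' hlow tendsto_const_nhds ?_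
      (Eventually.of_forall hgT)
    filter_upwards [hne] with h hh
    have h1 := hxg h hh
    rw [hexp] at h1
    have h2 : ‖T‖ - |h| ≤ ‖T + h • A h‖ := by
      have h3 := norm_sub_le (T + h • A h) (h • A h)
      rw [add_sub_cancel_right, norm_smul, Real.norm_eq_abs] at h3
      have h4 := mul_le_of_le_one_right (abs_nonneg h) (hA h)
      linarith
    linarith [le_abs_self (h * g h (A h (x h))), hgA h]
  obtain ⟨x₀, g₀, hx₀, hg₀, hgT₀, hxlim, hglim⟩ :=
    lp.exists_tendsto_norming_pair hq hqp hp hT l hx hg hlim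
  have hsub : ∀ (B : lp (fun _ : ℕ => ℝ) p →L[ℝ] lp (fun _ : ℕ => ℝ) q) (h : ℝ),
      h * g₀ (B x₀) ≤ ‖T + h • B‖ - ‖T‖ := by
    intro B h
    have h1 := (le_abs_self _).trans
      (ContinuousLinearMap.abs_apply_apply_le (S := T + h • B) hg₀ hx₀)
    have h2 : g₀ ((T + h • B) x₀) = ‖T‖ + h * g₀ (B x₀) := by simp [← hgT₀]
    linarith
  have hLB : ∀ B, L B = g₀ (B x₀) := fun B => eq_of_tendsto_of_mul_le (hL B) (hsub B)
  have hbound : Tendsto (fun h => ‖g h - g₀‖ + ‖x h - x₀‖ + |h|) l (𝓝 0) := by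
    simpa using (hglim.add hxlim).add habs
  refine squeeze_zero_norm' ?_ hbound
  filter_upwards [hne] with h hh
  have hpos : 0 < |h| := abs_pos.2 hh
  have hlow := hsub (A h) h
  have hup : ‖T + h • A h‖ - ‖T‖ ≤ h * g h (A h (x h)) + h ^ 2 := by
    have h1 := hxg h hh
    rw [hexp] at h1
    linarith [hgT h]
  have hdiff : h * g h (A h (x h)) - h * g₀ (A h x₀) ≤ |h| * (‖g h - g₀‖ + ‖x h - x₀‖) := by
    rw [← mul_sub]
    refine (le_abs_self _).trans ?_
    rw [abs_mul]
    gcongr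
    exact ContinuousLinearMap.abs_apply_apply_sub_le (hA h) hg₀ (hx h)
  rw [hLB, Real.norm_eq_abs, div_sub' hh, abs_div, div_le_iff₀ hpos, abs_of_nonneg (by linarith)]
  have hsq : |h| * |h| = h ^ 2 := by rw [← sq, sq_abs]
  linarith

theorem lp.normFrechetDifferentiableAt_of_normGateauxDifferentiableAt (hq : 1 < q) (hqp : q < p)
    (hp : p ≠ ∞) {T : lp (fun _ : ℕ => ℝ) p →L[ℝ] lp (fun _ : ℕ => ℝ) q}
    (hG : NormGateauxDifferentiableAt T) : NormFrechetDifferentiableAt T := by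
  rcases eq_or_ne T 0 with rfl | hT
  · refine ⟨0, fun u _ => Eventually.of_forall fun h A hA => ?_⟩
    rw [hG.eq_zero_of_zero A, mem_sphere_zero_iff_norm, _root_.norm_zero] at hA
    exact absurd hA zero_ne_one
  choose L hL using hG
  refine ⟨L, ?_⟩
  rw [Metric.tendstoUniformlyOn_iff]
  intro ε hε
  by_contra hfreq
  let P : ℝ → Prop := fun h => ∃ A : lp (fun _ : ℕ => ℝ) p →L[ℝ] lp (fun _ : ℕ => ℝ) q,
    ‖A‖ ≤ 1 ∧ ε ≤ |(‖T + h • A‖ - ‖T‖) / h - L A|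
  have hbad : ∃ᶠ h : ℝ in 𝓝[≠] 0, P h := by
    refine fun hev => hfreq (hev.mono fun h hh A hA => ?_)
    by_contra! hlt
    rw [dist_comm, Real.dist_eq] at hlt
    exact hh ⟨A, (mem_sphere_zero_iff_norm.1 hA).le, hlt⟩
  obtain ⟨l, hl⟩ := Filter.exists_ultrafilter_iff.2 (frequently_iff_neBot.1 hbad)
  have hP : ∀ᶠ h in (l : Filter ℝ), P h := Filter.le_principal_iff.1 (hl.trans inf_le_right)
  have hex : ∀ h : ℝ, ∃ A : lp (fun _ : ℕ => ℝ) p →L[ℝ] lp (fun _ : ℕ => ℝ) q, ‖A‖ ≤ 1 ∧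
      (P h → ε ≤ |(‖T + h • A‖ - ‖T‖) / h - L A|) := by
    intro h
    by_cases hh : P h
    · obtain ⟨A, hA, hA'⟩ := hh
      exact ⟨A, hA, fun _ => hA'⟩
    · exact ⟨0, by simp, fun hh' => absurd hh' hh⟩
  choose A hA hAP using hex
  have hlim := lp.tendsto_quotient_sub_of_tendsto hq hqp hp hT hL (hl.trans inf_le_left) hA
  obtain ⟨h, hPh, hlt⟩ := (hP.and (Metric.tendsto_nhds.1 hlim ε hε)).exists
  rw [Real.dist_eq, sub_zero] at hlt
  exact absurd (hAP h hPh) (not_le.2 hlt)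

end lp

theorem corollary3p10 (p q : ℝ≥0∞) [Fact (1 ≤ p)] [Fact (1 ≤ q)]
    (hq : 1 < q) (hqp : q < p) (hp : p ≠ ∞)
    (T : lp (fun _ : ℕ => ℝ) p →L[ℝ] lp (fun _ : ℕ => ℝ) q) :
    NormGateauxDifferentiableAt T ↔ NormFrechetDifferentiableAt T :=
  ⟨lp.normFrechetDifferentiableAt_of_normGateauxDifferentiableAt hq hqp hp,
    NormFrechetDifferentiableAt.normGateauxDifferentiableAt⟩
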